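/- For a group $\Gamma$ and a representation $A$ of $\Gamma$ over $\mathbb{Q}$ such that $H^i(\Gamma,A)$ is finite-dimensional for every $i\ge 0$ and nonzero for only finitely many $i$, let $\chi_h(\Gamma,A)=\sum_{i\ge 0}(-1)^i\dim_{\mathbb{Q}}H^i(\Gamma,A)$ denote its homological Euler characteristic. Let $V_2=\mathbb{Q}^2$ be the standard representation of $GL_2(\mathbb{Z})$, let $S^mV_2$ be its $m$-th symmetric power, and let $\det$ be the one-dimensional determinant representation of $GL_2(\mathbb{Z})$ over $\mathbb{Q}$. Then for every $m\ge 0$ the cohomology groups of $GL_2(\mathbb{Z})$ with coefficients in $S^mV_2$ and in $S^mV_2\otimes\det$ are finite-dimensional, and only finitely many of them are nonzero. Moreover, for every integer $n\ge 0$ and every $k$ that is one of $0,2,4,6,8,10$ or an odd positive integer, $$\chi_h(GL_2(\mathbb{Z}),S^{12n+k}V_2)=\begin{cases}-n+1 & k=0,\\ -n & k=2,4,6,8,\\ -n-1 & k=10,\\ 0 & k\text{ odd},\end{cases}$$ and $$\chi_h(GL_2(\mathbb{Z}),S^{12n+k}V_2\otimes\det)=\begin{cases}-n & k=0,\\ -n-1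 & k=2,4,6,8,\\ -n-2 & k=10,\\ 0 & k\text{ odd}.\end{cases}$$ -/

import Mathlib

open scoped TensorProduct

noncomputable section

namespace SymmetricPower

/-- The linear map `Symⁿ V → Symⁿ W` induced by a linear map `f : V → W`, sending
`v₁ ⋯ vₙ` to `f v₁ ⋯ f vₙ`. -/
def map {R V W : Type} [CommRing R] [AddCommGroup V] [Module R V] [AddCommGroup W] [Module R W]
    (n : ℕ) (f : V →ₗ[R] W) : SymmetricPower R (Fin n) V →ₗ[R] SymmetricPower R (Fin n) W where
  __ := AddCon.lift (addConGen (SymmetricPower.Rel R (Fin n) V))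
    ((SymmetricPower.mk R (Fin n) W).comp (PiTensorProduct.map fun _ => f)).toAddMonoidHom
    (by
      refine AddCon.addConGen_le.2 ?_
      intro x y h
      cases h with
      | perm e g =>
        simp only [AddCon.ker_rel, LinearMap.toAddMonoidHom_coe, LinearMap.comp_apply,
          PiTensorProduct.map_tprod]
        exact (SymmetricPower.tprod_equiv e fun i => f (g i)).symm)
  map_smul' r x := by
    induction x using AddCon.induction_on with
    | H x =>
      exact ((SymmetricPower.mk R (Fin n) W).comp (PiTensorProduct.map fun _ => f)).map_smul r x

theorem map_tprod {R V W : Type} [CommRing R] [AddCommGroup V] [Module R V] [AddCommGroup W]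
    [Module R W] (n : ℕ) (f : V →ₗ[R] W) (v : Fin n → V) :
    map n f (SymmetricPower.tprod R v) = SymmetricPower.tprod R fun i => f (v i) :=
  congrArg (SymmetricPower.mk R (Fin n) W) (PiTensorProduct.map_tprod (fun _ => f) v)

theorem hom_ext {R V W : Type} [CommRing R] [AddCommGroup V] [Module R V] [AddCommGroup W]
    [Module R W] {n : ℕ} {f g : SymmetricPower R (Fin n) V →ₗ[R] W}
    (h : ∀ v : Fin n → V, f (SymmetricPower.tprod R v) = g (SymmetricPower.tprod R v)) :
    f = g :=
  LinearMap.ext_on_range (SymmetricPower.span_tprod_eq_top R (Fin n) V) h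

end SymmetricPower

/-- The `n`-th symmetric power `Symⁿ V` of a representation `V` of a group `G`:
`g • (v₁ ⋯ vₙ) = (g • v₁) ⋯ (g • vₙ)`. -/
def Representation.symPow {R G V : Type} [CommRing R] [Group G] [AddCommGroup V] [Module R V]
    (ρ : Representation R G V) (n : ℕ) : Representation R G (SymmetricPower R (Fin n) V) where
  toFun g := SymmetricPower.map n (ρ g)
  map_one' := SymmetricPower.hom_ext fun v => by simp [SymmetricPower.map_tprod]
  map_mul' g h := SymmetricPower.hom_ext fun v => by simp [SymmetricPower.map_tprod]

/-- The standard representation `V₂` of `GL₂(ℤ)` on `ℚ²`. -/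
def standardRep : Representation ℚ (GL (Fin 2) ℤ) (Fin 2 → ℚ) where
  toFun g := Matrix.toLin' ((g : Matrix (Fin 2) (Fin 2) ℤ).map (Int.cast : ℤ → ℚ))
  map_one' := by simp [Module.End.one_eq_id]
  map_mul' g h := by
    rw [Module.End.mul_eq_comp, ← Matrix.toLin'_mul]
    exact congrArg _ (Matrix.map_mul (f := Int.castRingHom ℚ))

/-- The one-dimensional determinant representation of `GL₂(ℤ)` on `ℚ`. -/
def detRep : Representation ℚ (GL (Fin 2) ℤ) ℚ where
  toFun g := (((g : Matrix (Fin 2) (Fin 2) ℤ).det : ℤ) : ℚ) • LinearMap.id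
  map_one' := by ext; simp
  map_mul' g h := by ext; simp [mul_comm]

/-- `Sᵐ V₂` as a representation of `GL₂(ℤ)` over `ℚ`. -/
def symV (m : ℕ) : Rep ℚ (GL (Fin 2) ℤ) := Rep.of (standardRep.symPow m)

/-- `Sᵐ V₂ ⊗ det` as a representation of `GL₂(ℤ)` over `ℚ`. -/
def symVDet (m : ℕ) : Rep ℚ (GL (Fin 2) ℤ) :=
  CategoryTheory.MonoidalCategory.tensorObj (symV m) (Rep.of detRep)

/-- The total cohomology of `G` with coefficients in `A` is finite-dimensional, that is, the
homological Euler characteristic is a finite sum of finite dimensions. -/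
def HasFiniteCohomology {G : Type} [Group G] (A : Rep ℚ G) : Prop :=
  (∀ i : ℕ, Module.Finite ℚ (groupCohomology A i)) ∧
    {i : ℕ | Nontrivial (groupCohomology A i)}.Finite

/-- The homological Euler characteristic `χ_h(G, A) = ∑ᵢ (-1)ⁱ dim Hⁱ(G, A)`; it is meaningful
when `HasFiniteCohomology A` holds. -/
def homologicalEulerChar {G : Type} [Group G] (A : Rep ℚ G) : ℤ :=
  ∑ᶠ i : ℕ, (-1 : ℤ) ^ i * (Module.finrank ℚ (groupCohomology A i) : ℤ)

end

/-! `GL₂(ℤ)` acts on a tree with one edge as fundamental domain. Let `A`, `B` and `C = A ∩ B` be the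
dihedral groups of orders 8, 12 and 4 that are the ranges of `homFour`, `homSix` and `homTwo`. The
edges are the cosets of `C`, the vertices those of `A` and of `B`, and `gC` joins `gA` to `gB`. The
chain complex of the tree is a short exact sequence `0 → ℚ[G/C] → ℚ[G/A] ⊕ ℚ[G/B] → ℚ → 0`
(`Rep.boundary_shortExact`). The stabilizers are finite and `ℚ` has characteristic zero, so it is a
projective resolution of `ℚ` of length one. Since `Hom(ℚ[G/H], M) = M^H`, cohomology vanishes above
degree one and `χ_h(G, M) = dim M^A + dim M^B - dim M^C` (`hasFiniteCohomology_and_eulerChar`).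

The three dimensions are averages of the character of `M` (`eulerChar_eq`). For odd `m` the element
`-1` acts as `-1` and nothing is fixed. For even `m` the identity and `-1` together contribute `(m +
1)(1/4 + 1/6 - 1/2) = -(m + 1)/12`, while all other character values depend only on `m` modulo 12.
Hence adding 12 to `m` lowers `χ_h` by one, and only six residues remain. Twisting by `det` changes
the sign of the reflection terms. -/

open CategoryTheory Limits

/-! ### Fixed vectors and projectivity of the permutation modules `k[G ⧸ H]`. -/

namespace Representation

/-- The vectors fixed by a subgroup `H`. -/
noncomputable def fixedVectors {k G V : Type*} [CommRing k] [Group G] [AddCommGroup V] [Module k V]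
    (ρ : Representation k G V) (H : Subgroup G) : Submodule k V :=
  invariants (MonoidHom.comp ρ H.subtype)

theorem mem_fixedVectors {k G V : Type*} [CommRing k] [Group G] [AddCommGroup V] [Module k V]
    {ρ : Representation k G V} {H : Subgroup G} {v : V} :
    v ∈ ρ.fixedVectors H ↔ ∀ h ∈ H, ρ h v = v :=
  ⟨fun hv h hh => hv ⟨h, hh⟩, fun hv h => hv h.1 h.2⟩

end Representation

namespace Rep

universe u
variable {k G : Type u} [Field k] [Group G]

/-- The morphism `k[X] ⟶ M` extending an equivariant map `X → M`. -/
noncomputable def ofMulActionLift {X : Type u} [MulAction G X] {M : Rep.{u} k G} (f : X → M)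
    (hf : ∀ (g : G) (x : X), f (g • x) = M.ρ g (f x)) : ofMulAction k G X ⟶ M :=
  ofHom ⟨Finsupp.linearCombination k f ∘ₗ (MonoidAlgebra.coeffLinearEquiv k).toLinearMap,
    fun g => by ext x; simp [hf]⟩

theorem ofMulActionLift_single {X : Type u} [MulAction G X] {M : Rep.{u} k G} (f : X → M)
    (hf : ∀ (g : G) (x : X), f (g • x) = M.ρ g (f x)) (x : X) (r : k) :
    (ofMulActionLift f hf).hom (MonoidAlgebra.single x r) = r • f x := by
  simp [ofMulActionLift]

theorem ofMulAction_hom_ext {X : Type u} [MulAction G X] {M : Rep.{u} k G}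
    {f f' : ofMulAction k G X ⟶ M}
    (h : ∀ x : X, f.hom (MonoidAlgebra.single x 1) = f'.hom (MonoidAlgebra.single x 1)) :
    f = f' := by
  ext x
  simpa using h x

theorem ofMulAction_hom_smul {X : Type u} [MulAction G X] {M : Rep.{u} k G}
    (f : ofMulAction k G X ⟶ M) (g : G) (x : X) :
    f.hom (MonoidAlgebra.single (g • x) 1) = M.ρ g (f.hom (MonoidAlgebra.single x 1)) := by
  rw [← hom_comm_apply]; simp

/-- The equivariant map `G ⧸ H → M` determined by an `H`-invariant vector. -/
def cosetMap {M : Rep.{u} k G} (H : Subgroup G) (m : M.ρ.fixedVectors H) : G ⧸ H → M :=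
  Quotient.lift (fun g => M.ρ g m.1) fun a b hab => by
    have h := congrArg (M.ρ a) (Representation.mem_fixedVectors.1 m.2 _
      (QuotientGroup.leftRel_apply.mp hab))
    rw [← Module.End.mul_apply, ← map_mul, mul_inv_cancel_left] at h
    exact h.symm

@[simp] theorem cosetMap_mk {M : Rep.{u} k G} (H : Subgroup G) (m : M.ρ.fixedVectors H) (g : G) :
    cosetMap H m (g : G ⧸ H) = M.ρ g m.1 := rfl

theorem cosetMap_smul {M : Rep.{u} k G} (H : Subgroup G) (m : M.ρ.fixedVectors H) (g : G)
    (x : G ⧸ H) : cosetMap H m (g • x) = M.ρ g (cosetMap H m x) := by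
  induction x using QuotientGroup.induction_on with
  | H x =>
    rw [show g • (x : G ⧸ H) = ((g * x : G) : G ⧸ H) from rfl]
    simp

/-- The value of a morphism on a point stabilized by `H` is fixed by `H`. -/
theorem hom_single_mem_fixedVectors {X : Type u} [MulAction G X] {M : Rep.{u} k G}
    {H : Subgroup G} (f : ofMulAction k G X ⟶ M) {x : X} (hx : ∀ h ∈ H, h • x = x) :
    f.hom (MonoidAlgebra.single x 1) ∈ M.ρ.fixedVectors H :=
  Representation.mem_fixedVectors.2 fun h hh => by rw [← ofMulAction_hom_smul, hx _ hh]

theorem smul_coset_one {H : Subgroup G} (g : G) : g • ((1 : G) : G ⧸ H) = (g : G ⧸ H) :=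
  congrArg QuotientGroup.mk (mul_one g)

theorem smul_mk_one {H : Subgroup G} : ∀ h ∈ H, h • ((1 : G) : G ⧸ H) = ((1 : G) : G ⧸ H) := by
  intro h hh
  rw [smul_coset_one, QuotientGroup.eq]
  simpa using hh

/-- Average an arbitrary preimage over `H`; its order is invertible in characteristic zero. Thus `M
↦ M^H` preserves surjections, which is projectivity of `k[G ⧸ H]`. -/
theorem exists_fixed_lift [CharZero k] (H : Subgroup G) [Finite H]
    {M N : Rep.{u} k G} (p : M ⟶ N) (hp : Function.Surjective p.hom)
    {n : N} (hn : n ∈ N.ρ.fixedVectors H) : ∃ m ∈ M.ρ.fixedVectors H, p.hom m = n := by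
  have := Fintype.ofFinite H
  have hc : (Fintype.card H : k) ≠ 0 := by simp
  obtain ⟨m, hm⟩ := hp n
  refine ⟨(Fintype.card H : k)⁻¹ • ∑ x : H, M.ρ (x : G) m,
    Representation.mem_fixedVectors.2 fun y hy => ?_, ?_⟩
  · simp only [map_smul, map_sum]
    congr 1
    simp only [← Module.End.mul_apply, ← map_mul]
    exact Fintype.sum_equiv (Equiv.mulLeft (⟨y, hy⟩ : H)) _ _ fun x => rfl
  · have h : ∀ x : H, p.hom (M.ρ (x : G) m) = n := fun x => by
      rw [hom_comm_apply, hm]; exact Representation.mem_fixedVectors.1 hn x x.2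
    simp only [map_smul, map_sum, h, Finset.sum_const, Finset.card_univ]
    rw [← Nat.cast_smul_eq_nsmul k, inv_smul_smul₀ hc]

/-- Morphisms out of `k[G ⧸ H]` are the vectors fixed by `H`. -/
noncomputable def cosetHomEquiv (H : Subgroup G) (M : Rep.{u} k G) :
    (ofMulAction k G (G ⧸ H) ⟶ M) ≃ₗ[k] M.ρ.fixedVectors H where
  toFun f := ⟨f.hom (MonoidAlgebra.single ((1 : G) : G ⧸ H) 1),
    hom_single_mem_fixedVectors f smul_mk_one⟩
  map_add' f f' := rfl
  map_smul' r f := rfl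
  invFun m := ofMulActionLift (cosetMap H m) (cosetMap_smul H m)
  left_inv f := ofMulAction_hom_ext fun x => by
    induction x using QuotientGroup.induction_on with
    | H x =>
      rw [ofMulActionLift_single, one_smul, cosetMap_mk, ← ofMulAction_hom_smul]
      rw [smul_coset_one]
  right_inv m := Subtype.ext <| (ofMulActionLift_single _ _ _ _).trans (by simp)

variable (A B : Subgroup G)

/-- Morphisms out of `k[G ⧸ A ⊔ G ⧸ B]` are pairs of vectors fixed by `A` and by `B`. -/
noncomputable def sumCosetHomEquiv (M : Rep.{u} k G) :
    (ofMulAction k G ((G ⧸ A) ⊕ (G ⧸ B)) ⟶ M) ≃ₗ[k]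
      M.ρ.fixedVectors A × M.ρ.fixedVectors B where
  toFun f := (⟨f.hom (MonoidAlgebra.single (Sum.inl ((1 : G) : G ⧸ A)) 1),
      hom_single_mem_fixedVectors f fun h hh => congrArg Sum.inl (smul_mk_one h hh)⟩,
    ⟨f.hom (MonoidAlgebra.single (Sum.inr ((1 : G) : G ⧸ B)) 1),
      hom_single_mem_fixedVectors f fun h hh => congrArg Sum.inr (smul_mk_one h hh)⟩)
  map_add' f f' := rfl
  map_smul' r f := rfl
  invFun m := ofMulActionLift (Sum.elim (cosetMap A m.1) (cosetMap B m.2)) fun g x => by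
    rcases x with x | x
    · exact cosetMap_smul A m.1 g x
    · exact cosetMap_smul B m.2 g x
  left_inv f := ofMulAction_hom_ext fun x => by
    rw [ofMulActionLift_single, one_smul]
    rcases x with x | x <;> induction x using QuotientGroup.induction_on with
    | H x =>
      refine (ofMulAction_hom_smul f x _).symm.trans ?_
      simp only [Sum.smul_inl, Sum.smul_inr, smul_coset_one]
  right_inv m := by
    ext
    · exact (ofMulActionLift_single _ _ _ _).trans (by simp)
    · exact (ofMulActionLift_single _ _ _ _).trans (by simp)

instance projective_coset [CharZero k] (H : Subgroup G) [Finite H] :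
    Projective (ofMulAction k G (G ⧸ H)) where
  factors {N M} f p hp := by
    obtain ⟨m, hm, h⟩ := exists_fixed_lift H p ((epi_iff_surjective p).1 hp)
      (cosetHomEquiv H _ f).2
    refine ⟨(cosetHomEquiv H _).symm ⟨m, hm⟩, (cosetHomEquiv H _).injective (Subtype.ext ?_)⟩
    rw [← h]
    exact congrArg p.hom (congrArg Subtype.val ((cosetHomEquiv H _).apply_symm_apply ⟨m, hm⟩))

instance projective_sumCoset [CharZero k] [Finite A] [Finite B] :
    Projective (ofMulAction k G ((G ⧸ A) ⊕ (G ⧸ B))) where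
  factors {N M} f p hp := by
    have hs := (epi_iff_surjective p).1 hp
    obtain ⟨a, ha, h⟩ := exists_fixed_lift A p hs (sumCosetHomEquiv A B _ f).1.2
    obtain ⟨b, hb, h'⟩ := exists_fixed_lift B p hs (sumCosetHomEquiv A B _ f).2.2
    have key := (sumCosetHomEquiv A B _).apply_symm_apply (⟨a, ha⟩, ⟨b, hb⟩)
    refine ⟨(sumCosetHomEquiv A B _).symm (⟨a, ha⟩, ⟨b, hb⟩),
      (sumCosetHomEquiv A B _).injective (Prod.ext (Subtype.ext ?_) (Subtype.ext ?_))⟩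
    · rw [← h]
      exact congrArg p.hom (congrArg Subtype.val (congrArg Prod.fst key))
    · rw [← h']
      exact congrArg p.hom (congrArg Subtype.val (congrArg Prod.snd key))

end Rep

/-! ### Cohomology and Euler characteristic from a projective resolution of length one. -/

open scoped ZeroObject

namespace CategoryTheory.ShortComplex.ShortExact

universe v u
variable {C : Type u} [Category.{v} C] [Abelian C] {S : ShortComplex C}

/-- The objects of the complex `⋯ ⟶ 0 ⟶ X₁ ⟶ X₂`. -/
noncomputable def resolutionX (S : ShortComplex C) : ℕ → C
  | 0 => S.X₂
  | 1 => S.X₁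
  | _ + 2 => 0

/-- The differentials of the complex `⋯ ⟶ 0 ⟶ X₁ ⟶ X₂`. -/
noncomputable def resolutionD (S : ShortComplex C) :
    (n : ℕ) → (resolutionX S (n + 1) ⟶ resolutionX S n)
  | 0 => S.f
  | _ + 1 => 0

/-- The complex `⋯ ⟶ 0 ⟶ X₁ ⟶ X₂`. -/
noncomputable def resolutionComplex (S : ShortComplex C) : ChainComplex C ℕ :=
  ChainComplex.of (resolutionX S) (resolutionD S) fun n => by
    rw [show resolutionD S (n + 1) = 0 from rfl, zero_comp]

theorem resolutionComplex_d (S : ShortComplex C) : (resolutionComplex S).d 1 0 = S.f :=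
  ChainComplex.of_d (X := resolutionX S) (d := resolutionD S) 0

theorem resolutionComplex_isZero (S : ShortComplex C) (n : ℕ) :
    IsZero ((resolutionComplex S).X (n + 2)) := isZero_zero C

/-- A short exact sequence `0 ⟶ X₁ ⟶ X₂ ⟶ X₃ ⟶ 0` with `X₁` and `X₂` projective is a projective
resolution of `X₃`. -/
noncomputable def projectiveResolution (hS : S.ShortExact) [Projective S.X₁] [Projective S.X₂] :
    ProjectiveResolution S.X₃ where
  complex := resolutionComplex S
  projective n := by
    rcases n with _ | _ | n
    · exact inferInstanceAs (Projective S.X₂)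
    · exact inferInstanceAs (Projective S.X₁)
    · exact (resolutionComplex_isZero S n).projective
  π := (ChainComplex.toSingle₀Equiv _ _).symm ⟨S.g, by
    rw [resolutionComplex_d]; exact S.zero⟩
  quasiIso := ⟨fun n => by
    have hw : (resolutionComplex S).d 1 0 ≫ S.g = 0 := by rw [resolutionComplex_d]; exact S.zero
    have hπ := ChainComplex.toSingle₀Equiv_symm_apply_f_zero (C := resolutionComplex S) S.g hw
    rcases n with _ | _ | n
    · rw [ChainComplex.quasiIsoAt₀_iff, ShortComplex.quasiIso_iff_of_zeros']
      · refine (ShortComplex.exact_and_epi_g_iff_of_iso (S₂ := S) ?_).2 ⟨hS.exact, hS.epi_g⟩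
        exact ShortComplex.isoMk (Iso.refl _) (Iso.refl _) (Iso.refl _)
          ((Category.id_comp _).trans ((resolutionComplex_d S).symm.trans (Category.comp_id _).symm))
          ((Category.id_comp _).trans (.trans
            hπ.symm (Category.comp_id _).symm))
      all_goals rfl
    · rw [quasiIsoAt_iff_exactAt' _ _ (ChainComplex.exactAt_succ_single_obj _ _),
        HomologicalComplex.exactAt_iff' _ 2 1 0 (by simp) (by simp)]
      rw [ShortComplex.exact_iff_mono]
      · change Mono ((resolutionComplex S).d 1 0)
        rw [resolutionComplex_d]
        exact hS.mono_f
      · exact (resolutionComplex_isZero S 0).eq_of_src _ _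
    · rw [quasiIsoAt_iff_exactAt' _ _ (ChainComplex.exactAt_succ_single_obj _ _)]
      exact HomologicalComplex.ExactAt.of_isZero (resolutionComplex_isZero S n)⟩

end CategoryTheory.ShortComplex.ShortExact

namespace CategoryTheory.ShortComplex

universe u
variable {k : Type u} [Field k] (S : ShortComplex (ModuleCat.{u} k)) [Module.Finite k S.X₂]

theorem finite_homology : Module.Finite k S.homology :=
  have : Module.Finite k S.moduleCatLeftHomologyData.H :=
    Module.Finite.quotient k (LinearMap.range S.moduleCatToCycles)
  Module.Finite.equiv S.moduleCatHomologyIso.toLinearEquiv.symm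

/-- Rank-nullity for the outgoing map, combined with homology as cycles modulo the image of the
incoming map. -/
theorem finrank_homology_add :
    Module.finrank k S.homology + Module.finrank k (LinearMap.range S.f.hom) +
      Module.finrank k (LinearMap.range S.g.hom) = Module.finrank k S.X₂ := by
  have h1 : Module.finrank k S.homology =
      Module.finrank k (LinearMap.ker S.g.hom ⧸ LinearMap.range S.moduleCatToCycles) :=
    S.moduleCatHomologyIso.toLinearEquiv.finrank_eq
  have h2 := Submodule.finrank_quotient_add_finrank (LinearMap.range S.moduleCatToCycles)
  have h3 : Module.finrank k (LinearMap.range S.moduleCatToCycles) =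
      Module.finrank k (LinearMap.range S.f.hom) := by
    rw [← Submodule.finrank_map_subtype_eq (LinearMap.ker S.g.hom), ← LinearMap.range_comp]
    rfl
  have h4 := LinearMap.finrank_range_add_finrank_ker S.g.hom
  omega

end CategoryTheory.ShortComplex

namespace CochainComplex

universe u
variable {k : Type u} [Field k] (K : CochainComplex (ModuleCat.{u} k) ℕ)

theorem finite_homology (n : ℕ) [Module.Finite k (K.X n)] : Module.Finite k (K.homology n) :=
  have : Module.Finite k (K.sc n).X₂ := ‹_›
  (K.sc n).finite_homology

/-- The rank of `d 0 1` is subtracted once from each of the two degrees, so it cancels in the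
difference. -/
theorem finrank_homology_zero_sub_one [Module.Finite k (K.X 0)] [Module.Finite k (K.X 1)]
    (h : K.d 1 2 = 0) :
    (Module.finrank k (K.homology 0) : ℤ) - Module.finrank k (K.homology 1) =
      Module.finrank k (K.X 0) - Module.finrank k (K.X 1) := by
  have e0 := (ShortComplex.homologyMapIso
    (K.isoSc' 0 0 1 (by simp) (by simp))).toLinearEquiv.finrank_eq
  have e1 := (ShortComplex.homologyMapIso
    (K.isoSc' 0 1 2 (by simp) (by simp))).toLinearEquiv.finrank_eq
  have : Module.Finite k (K.sc' 0 0 1).X₂ := ‹Module.Finite k (K.X 0)›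
  have : Module.Finite k (K.sc' 0 1 2).X₂ := ‹Module.Finite k (K.X 1)›
  have h0 := (K.sc' 0 0 1).finrank_homology_add
  have h1 := (K.sc' 0 1 2).finrank_homology_add
  -- By convention the index preceding 0 is 0 itself, and the map `d 0 0` vanishes because it is not
  -- a differential of the complex.
  have r0 : Module.finrank k (LinearMap.range (K.sc' 0 0 1).f.hom) = 0 := by
    rw [show (K.sc' 0 0 1).f = 0 from K.shape 0 0 (by simp)]
    simp
  have r1 : Module.finrank k (LinearMap.range (K.sc' 0 1 2).g.hom) = 0 := by
    rw [show (K.sc' 0 1 2).g = 0 from h]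
    simp
  have hr : Module.finrank k (LinearMap.range (K.sc' 0 0 1).g.hom) =
    Module.finrank k (LinearMap.range (K.sc' 0 1 2).f.hom) := rfl
  have hx0 : Module.finrank k (K.sc' 0 0 1).X₂ = Module.finrank k (K.X 0) := rfl
  have hx1 : Module.finrank k (K.sc' 0 1 2).X₂ = Module.finrank k (K.X 1) := rfl
  have f0 : Module.finrank k (K.homology 0) = Module.finrank k (K.sc' 0 0 1).homology := e0
  have f1 : Module.finrank k (K.homology 1) = Module.finrank k (K.sc' 0 1 2).homology := e1
  omega

end CochainComplex

/-- Group cohomology is the cohomology of `Hom(P₀, A) → Hom(P₁, A) → 0`. -/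
theorem hasFiniteCohomology_and_eulerChar_of_shortExact {G : Type} [Group G]
    {P₁ P₀ : Rep.{0} ℚ G}
    {f : P₁ ⟶ P₀} {g : P₀ ⟶ Rep.trivial ℚ G ℚ} {w : f ≫ g = 0}
    (hS : (ShortComplex.mk f g w).ShortExact) [hP₁ : Projective P₁] [hP₀ : Projective P₀]
    (A : Rep.{0} ℚ G) [h₁ : Module.Finite ℚ (P₁ ⟶ A)] [h₀ : Module.Finite ℚ (P₀ ⟶ A)] :
    HasFiniteCohomology A ∧ homologicalEulerChar A =
      Module.finrank ℚ (P₀ ⟶ A) - Module.finrank ℚ (P₁ ⟶ A) := by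
  have : Projective (ShortComplex.mk f g w).X₁ := hP₁
  have : Projective (ShortComplex.mk f g w).X₂ := hP₀
  let R : ProjectiveResolution (Rep.trivial ℚ G ℚ) := hS.projectiveResolution
  let K := R.complex.linearYonedaObj ℚ A
  have e (n : ℕ) : groupCohomology A n ≃ₗ[ℚ] K.homology n :=
    (groupCohomologyIso A n R).toLinearEquiv
  have hz (n : ℕ) : IsZero (K.X (n + 2)) :=
    ModuleCat.isZero_of_iff_subsingleton.2 ⟨fun a b =>
      (ShortComplex.ShortExact.resolutionComplex_isZero (ShortComplex.mk f g w) n).eq_of_src a b⟩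
  have f0 : Module.Finite ℚ (K.X 0) := h₀
  have f1 : Module.Finite ℚ (K.X 1) := h₁
  have hs (n : ℕ) : Subsingleton (groupCohomology A (n + 2)) := by
    have : IsZero (K.homology (n + 2)) :=
      (HomologicalComplex.ExactAt.of_isZero (hz n)).isZero_homology
    have := ModuleCat.isZero_iff_subsingleton.1 this
    exact (e (n + 2)).toEquiv.subsingleton
  refine ⟨⟨fun n => ?_, (Set.finite_lt_nat 2).subset fun n hn => ?_⟩, ?_⟩
  · rcases n with _ | _ | n
    · have := K.finite_homology 0
      exact Module.Finite.equiv (e 0).symm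
    · have := K.finite_homology 1
      exact Module.Finite.equiv (e 1).symm
    · infer_instance
  · by_contra hlt
    obtain ⟨m, rfl⟩ := Nat.exists_eq_add_of_le' (not_lt.1 hlt)
    exact not_nontrivial_iff_subsingleton.2 (hs m) hn
  · rw [homologicalEulerChar, finsum_eq_sum_of_support_subset (s := Finset.range 2)]
    · have h := K.finrank_homology_zero_sub_one ((hz 0).eq_of_tgt _ _)
      rw [← (e 0).finrank_eq, ← (e 1).finrank_eq] at h
      simp only [Finset.sum_range_succ, Finset.sum_range_zero, pow_zero, pow_one]
      have k0 : Module.finrank ℚ (K.X 0) = Module.finrank ℚ (P₀ ⟶ A) := rfl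
      have k1 : Module.finrank ℚ (K.X 1) = Module.finrank ℚ (P₁ ⟶ A) := rfl
      rw [k0, k1] at h
      linarith
    · intro n hn
      simp only [Finset.coe_range, Set.mem_Iio]
      by_contra hlt
      obtain ⟨m, rfl⟩ := Nat.exists_eq_add_of_le' (not_lt.1 hlt)
      have := hs m
      simp [Module.finrank_zero_of_subsingleton] at hn

/-! ### The chain complex of a graph with edge set `G ⧸ C` and vertex set `G ⧸ A ⊔ G ⧸ B`. -/

namespace Rep

universe u
variable (k : Type u) {G : Type u} [Field k] [Group G] {A B C : Subgroup G}

/-- The boundary map `k[G ⧸ C] ⟶ k[G ⧸ A ⊔ G ⧸ B]` of the graph with edges `G ⧸ C`, the edge `gC`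
joining the vertices `gA` and `gB`. -/
noncomputable def boundary (hA : C ≤ A) (hB : C ≤ B) :
    ofMulAction k G (G ⧸ C) ⟶ ofMulAction k G ((G ⧸ A) ⊕ (G ⧸ B)) :=
  ofMulActionLift (fun e => MonoidAlgebra.single (Sum.inl (Subgroup.quotientMapOfLE hA e)) 1 -
    MonoidAlgebra.single (Sum.inr (Subgroup.quotientMapOfLE hB e)) 1) fun g e => by
    induction e using QuotientGroup.induction_on with
    | H x =>
      rw [map_sub, Representation.ofMulAction_single, Representation.ofMulAction_single]
      rfl

/-- The augmentation `k[X] ⟶ k`. -/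
noncomputable def augmentation (X : Type u) [MulAction G X] :
    ofMulAction k G X ⟶ trivial k G k :=
  ofMulActionLift (fun _ => (1 : k)) fun _ _ => rfl

variable {k}

theorem boundary_single (hA : C ≤ A) (hB : C ≤ B) (e : G ⧸ C) (r : k) :
    (boundary k hA hB).hom (MonoidAlgebra.single e r) =
      MonoidAlgebra.single (Sum.inl (Subgroup.quotientMapOfLE hA e)) r -
      MonoidAlgebra.single (Sum.inr (Subgroup.quotientMapOfLE hB e)) r := by
  refine (ofMulActionLift_single _ _ _ _).trans ?_
  rw [smul_sub, MonoidAlgebra.smul_single, MonoidAlgebra.smul_single, smul_eq_mul, mul_one]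

theorem augmentation_single {X : Type u} [MulAction G X] (x : X) (r : k) :
    (augmentation k X (G := G)).hom (MonoidAlgebra.single x r) = r :=
  (ofMulActionLift_single _ _ _ _).trans (mul_one r)

theorem boundary_comp_augmentation (hA : C ≤ A) (hB : C ≤ B) :
    boundary k hA hB ≫ augmentation k _ = 0 :=
  ofMulAction_hom_ext fun e => by
    refine (congrArg (augmentation k _ (G := G)).hom (boundary_single hA hB e 1)).trans ?_
    rw [map_sub, augmentation_single, augmentation_single, sub_self]
    rfl

open Classical in
theorem coeff_boundary_inl (hA : C ≤ A) (hB : C ≤ B) (x : MonoidAlgebra k (G ⧸ C)) (v : G ⧸ A) :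
    ((boundary k hA hB).hom x : MonoidAlgebra k ((G ⧸ A) ⊕ (G ⧸ B))).coeff (Sum.inl v) =
      x.coeff.sum fun e r => if Subgroup.quotientMapOfLE hA e = v then r else 0 := by
  induction x using MonoidAlgebra.induction_linear with
  | zero => rw [map_zero]; simp
  | add x y hx hy =>
    rw [map_add, MonoidAlgebra.coeff_add, MonoidAlgebra.coeff_add, Finsupp.add_apply, hx, hy,
      Finsupp.sum_add_index' (by simp) (by intros; split_ifs <;> simp)]
  | single e r =>
    rw [boundary_single]
    simp [Finsupp.single_apply]

open Classical in
theorem coeff_boundary_inr (hA : C ≤ A) (hB : C ≤ B) (x : MonoidAlgebra k (G ⧸ C)) (v : G ⧸ B) :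
    ((boundary k hA hB).hom x : MonoidAlgebra k ((G ⧸ A) ⊕ (G ⧸ B))).coeff (Sum.inr v) =
      -x.coeff.sum fun e r => if Subgroup.quotientMapOfLE hB e = v then r else 0 := by
  induction x using MonoidAlgebra.induction_linear with
  | zero => rw [map_zero]; simp
  | add x y hx hy =>
    rw [map_add, MonoidAlgebra.coeff_add, MonoidAlgebra.coeff_add, Finsupp.add_apply, hx, hy,
      Finsupp.sum_add_index' (by simp) (by intros; split_ifs <;> simp), neg_add]
  | single e r =>
    rw [boundary_single]
    simp [Finsupp.single_apply]

theorem sum_fiber_eq {E V : Type*} (x : E →₀ k) (p : E → V) (e : E)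
    [∀ e', Decidable (p e' = p e)]
    (h : ∀ e' ∈ x.support, p e' = p e → e' = e) :
    (x.sum fun e' r => if p e' = p e then r else 0) = x e := by
  rw [Finsupp.sum, Finset.sum_eq_single e]
  · simp
  · intro e' he' hne
    exact if_neg fun hp => hne (h e' he' hp)
  · intro he
    simpa using he

/-- If the edges carry a height such that each edge is lower than all others at one of its ends,
then the graph has no cycles. -/
theorem boundary_injective (hA : C ≤ A) (hB : C ≤ B) (ht : G ⧸ C → ℤ)
    (h : ∀ e, (∀ e', Subgroup.quotientMapOfLE hA e' = Subgroup.quotientMapOfLE hA e → e' ≠ e →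
        ht e < ht e') ∨
      (∀ e', Subgroup.quotientMapOfLE hB e' = Subgroup.quotientMapOfLE hB e → e' ≠ e →
        ht e < ht e')) :
    Function.Injective (boundary k hA hB).hom := by
  classical
  refine (injective_iff_map_eq_zero _).2 fun (x : MonoidAlgebra k (G ⧸ C)) hx => ?_
  by_contra hne
  have hs : x.coeff.support.Nonempty := by
    rwa [Finsupp.support_nonempty_iff, Ne, MonoidAlgebra.coeff_eq_zero]
  obtain ⟨e, he, hmax⟩ := x.coeff.support.exists_max_image ht hs
  have hxe : x.coeff e ≠ 0 := Finsupp.mem_support_iff.1 he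
  -- `e` is a highest edge in the support of the cycle `x`. At one of its ends all other edges are
  -- strictly higher, hence outside the support, so the boundary of `x` has coefficient `± x e` at
  -- that vertex.
  rcases h e with h | h
  · have h1 := coeff_boundary_inl hA hB x (Subgroup.quotientMapOfLE hA e)
    rw [hx, sum_fiber_eq x.coeff (Subgroup.quotientMapOfLE hA)] at h1
    · exact hxe h1.symm
    · exact fun e' he' hp => by_contra fun hn => absurd (hmax e' he') (not_le.2 (h e' hp hn))
  · have h1 := coeff_boundary_inr hA hB x (Subgroup.quotientMapOfLE hB e)
    rw [hx, sum_fiber_eq x.coeff (Subgroup.quotientMapOfLE hB)] at h1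
    · exact hxe (neg_eq_zero.1 h1.symm)
    · exact fun e' he' hp => by_contra fun hn => absurd (hmax e' he') (not_le.2 (h e' hp hn))

/-- If `A` and `B` generate `G`, then the graph is connected. -/
theorem ker_augmentation_le_range_boundary (hA : C ≤ A) (hB : C ≤ B) (hAB : A ⊔ B = ⊤)
    (x : MonoidAlgebra k ((G ⧸ A) ⊕ (G ⧸ B))) (hx : (augmentation k _ (G := G)).hom x = 0) :
    ∃ y, (boundary k hA hB).hom y = x := by
  let N : Submodule k (MonoidAlgebra k ((G ⧸ A) ⊕ (G ⧸ B))) :=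
    LinearMap.range (boundary k hA hB).hom.toLinearMap
  have hN (g : G) : (MonoidAlgebra.single (Sum.inl (g : G ⧸ A)) 1 -
      MonoidAlgebra.single (Sum.inr (g : G ⧸ B)) 1 : MonoidAlgebra k _) ∈ N :=
    ⟨MonoidAlgebra.single (g : G ⧸ C) 1, boundary_single hA hB _ _⟩
  -- Modulo boundaries `gA` and `ghA` agree, by induction on `h` as a word in `A` and `B`. A letter
  -- of `A` does not move the vertex; for a letter of `B` both vertices are adjacent to `gB`.
  have hgen (h : G) : h ∈ A ⊔ B → ∀ g : G,
      (MonoidAlgebra.single (Sum.inl ((g * h : G) : G ⧸ A)) 1 -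
      MonoidAlgebra.single (Sum.inl (g : G ⧸ A)) 1 : MonoidAlgebra k ((G ⧸ A) ⊕ (G ⧸ B))) ∈ N := by
    intro hh
    rw [Subgroup.sup_eq_closure] at hh
    induction hh using Subgroup.closure_induction with
    | mem h hh =>
      intro g
      rcases hh with hh | hh
      · rw [show ((g * h : G) : G ⧸ A) = g from QuotientGroup.mk_mul_of_mem g hh, sub_self]
        exact N.zero_mem
      · have h2 : ((g * h : G) : G ⧸ B) = g := QuotientGroup.mk_mul_of_mem g hh
        have h1 := N.sub_mem (hN (g * h)) (hN g)
        rwa [h2, sub_sub_sub_cancel_right] at h1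
    | one => intro g; rw [mul_one, sub_self]; exact N.zero_mem
    | mul a b _ _ ha hb =>
      intro g
      have := N.add_mem (hb (g * a)) (ha g)
      rwa [sub_add_sub_cancel, mul_assoc] at this
    | inv a _ ha =>
      intro g
      have := N.neg_mem (ha (g * a⁻¹))
      rwa [neg_sub, inv_mul_cancel_right] at this
  have hbase (v : (G ⧸ A) ⊕ (G ⧸ B)) : (MonoidAlgebra.single v 1 -
      MonoidAlgebra.single (Sum.inl ((1 : G) : G ⧸ A)) 1 : MonoidAlgebra k _) ∈ N := by
    rcases v with v | v <;> induction v using QuotientGroup.induction_on with | H g => ?_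
    · simpa using hgen g (hAB ▸ Subgroup.mem_top g) 1
    · have := N.sub_mem (hgen g (hAB ▸ Subgroup.mem_top g) 1) (hN g)
      rwa [one_mul, sub_sub_sub_cancel_left] at this
  -- All vertices are homologous to the base vertex, so a chain is homologous to its augmentation
  -- times that vertex.
  have hall (y : MonoidAlgebra k ((G ⧸ A) ⊕ (G ⧸ B))) : y - (augmentation k _ (G := G)).hom y •
      MonoidAlgebra.single (Sum.inl ((1 : G) : G ⧸ A)) (1 : k) ∈ N := by
    induction y using MonoidAlgebra.induction_linear with
    | zero => rw [map_zero, zero_smul, sub_zero]; exact N.zero_mem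
    | add y z hy hz =>
      rw [map_add, add_smul, add_sub_add_comm]
      exact N.add_mem hy hz
    | single v r =>
      rw [augmentation_single]
      have := N.smul_mem r (hbase v)
      rwa [smul_sub, MonoidAlgebra.smul_single r v, smul_eq_mul, mul_one] at this
  have := hall x
  rw [hx, zero_smul, sub_zero] at this
  exact this

theorem boundary_shortExact (hA : C ≤ A) (hB : C ≤ B) (hAB : A ⊔ B = ⊤) (ht : G ⧸ C → ℤ)
    (h : ∀ e, (∀ e', Subgroup.quotientMapOfLE hA e' = Subgroup.quotientMapOfLE hA e → e' ≠ e →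
        ht e < ht e') ∨
      (∀ e', Subgroup.quotientMapOfLE hB e' = Subgroup.quotientMapOfLE hB e → e' ≠ e →
        ht e < ht e')) :
    (ShortComplex.mk _ _ (boundary_comp_augmentation (k := k) hA hB)).ShortExact where
  exact := by
    apply (forget₂ _ (ModuleCat k)).reflects_exact_of_faithful
    rw [ShortComplex.moduleCat_exact_iff]
    exact fun x hx => ker_augmentation_le_range_boundary hA hB hAB x hx
  mono_f := (mono_iff_injective _).2 (boundary_injective hA hB ht h)
  epi_g := (epi_iff_surjective _).2 fun r =>
    ⟨MonoidAlgebra.single (Sum.inl ((1 : G) : G ⧸ A)) r, augmentation_single _ _⟩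

end Rep

/-- The terms of the resolution represent fixed vectors, so the dimensions of the Hom spaces become
those of `M^A`, `M^B` and `M^C`. -/
theorem hasFiniteCohomology_and_eulerChar_of_tree {G : Type} [Group G] {A B C : Subgroup G}
    [Finite A] [Finite B]
    (hA : C ≤ A) (hB : C ≤ B) (hAB : A ⊔ B = ⊤) (ht : G ⧸ C → ℤ)
    (h : ∀ e, (∀ e', Subgroup.quotientMapOfLE hA e' = Subgroup.quotientMapOfLE hA e → e' ≠ e →
        ht e < ht e') ∨
      (∀ e', Subgroup.quotientMapOfLE hB e' = Subgroup.quotientMapOfLE hB e → e' ≠ e →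
        ht e < ht e')) (M : Rep.{0} ℚ G) [Module.Finite ℚ M] :
    HasFiniteCohomology M ∧ homologicalEulerChar M =
      Module.finrank ℚ (M.ρ.fixedVectors A) + Module.finrank ℚ (M.ρ.fixedVectors B) -
        Module.finrank ℚ (M.ρ.fixedVectors C) := by
  have : Finite C := Finite.of_injective _ (Subgroup.inclusion_injective hA)
  have := Module.Finite.equiv (Rep.sumCosetHomEquiv A B M).symm
  have := Module.Finite.equiv (Rep.cosetHomEquiv C M).symm
  have key := hasFiniteCohomology_and_eulerChar_of_shortExact
    (Rep.boundary_shortExact hA hB hAB ht h) M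
  rwa [(Rep.sumCosetHomEquiv A B M).finrank_eq, (Rep.cosetHomEquiv C M).finrank_eq,
    Module.finrank_prod, Nat.cast_add] at key

/-! ### The dihedral subgroups and the tree of `GL₂(ℤ)`. -/

namespace DihedralGroup

variable {G : Type*} [Group G] {n : ℕ} [NeZero n]

/-- The homomorphism `DihedralGroup n →* G` sending the rotation `r 1` to `a` and the reflection
`sr 0` to `b`. -/
def liftHom (a b : G) (ha : a ^ n = 1) (hb : b * b = 1) (hab : b * a * b = a⁻¹) :
    DihedralGroup n →* G :=
  have hadd (i j : ZMod n) : a ^ (i + j).val = a ^ i.val * a ^ j.val := by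
    rw [ZMod.val_add, ← pow_eq_pow_mod _ ha, pow_add]
  have hsub (i j : ZMod n) : a ^ (j - i).val = (a ^ i.val)⁻¹ * a ^ j.val := by
    have := hadd i (j - i)
    rw [add_sub_cancel] at this
    rw [this, inv_mul_cancel_left]
  have hbi : b⁻¹ = b := inv_eq_of_mul_eq_one_left hb
  have hconj (i : ℕ) : a ^ i * b = b * (a ^ i)⁻¹ := by
    have h1 : (b * a * b⁻¹) ^ i = (a ^ i)⁻¹ := by rw [hbi, hab, inv_pow]
    rw [conj_pow, hbi] at h1
    rw [← h1, ← mul_assoc, ← mul_assoc, hb, one_mul]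
  { toFun := fun
      | r i => a ^ i.val
      | sr i => b * a ^ i.val
    map_one' := by
      change a ^ (0 : ZMod n).val = 1
      simp
    map_mul' := by
      rintro (i | i) (j | j)
      · exact hadd i j
      · change b * a ^ (j - i).val = a ^ i.val * (b * a ^ j.val)
        rw [hsub, ← mul_assoc, ← mul_assoc, hconj]
      · change b * a ^ (i + j).val = b * a ^ i.val * a ^ j.val
        rw [hadd, mul_assoc]
      · change a ^ (j - i).val = b * a ^ i.val * (b * a ^ j.val)
        rw [hsub, ← mul_assoc, mul_assoc b, hconj, ← mul_assoc, hb, one_mul] }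

end DihedralGroup

namespace GLTwoInt

/-- The rotation of order four. -/
def rotFour : GL (Fin 2) ℤ :=
  ⟨!![0, -1; 1, 0], !![0, 1; -1, 0], by decide, by decide⟩

/-- The rotation of order six. -/
def rotSix : GL (Fin 2) ℤ :=
  ⟨!![0, -1; 1, 1], !![1, 1; -1, 0], by decide, by decide⟩

/-- The reflection exchanging the two basis vectors. -/
def swap : GL (Fin 2) ℤ :=
  ⟨!![0, 1; 1, 0], !![0, 1; 1, 0], by decide, by decide⟩

/-- The reflection in the first coordinate axis. -/
def refl : GL (Fin 2) ℤ :=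
  ⟨!![1, 0; 0, -1], !![1, 0; 0, -1], by decide, by decide⟩

/-- The action of the dihedral group of order eight. -/
def homFour : DihedralGroup 4 →* GL (Fin 2) ℤ :=
  DihedralGroup.liftHom rotFour swap (by decide) (by decide) (by decide)

/-- The action of the dihedral group of order twelve. -/
def homSix : DihedralGroup 6 →* GL (Fin 2) ℤ :=
  DihedralGroup.liftHom rotSix swap (by decide) (by decide) (by decide)

/-- The action of the dihedral group of order four. -/
def homTwo : DihedralGroup 2 →* GL (Fin 2) ℤ :=
  DihedralGroup.liftHom (-1) swap (by decide) (by decide) (by decide)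

theorem homTwo_mem (x : DihedralGroup 2) :
    homTwo x = 1 ∨ homTwo x = -1 ∨ homTwo x = swap ∨ homTwo x = -swap := by
  revert x; decide

/-- Coset representatives modulo the edge group: a vertex of type `A` has at most one further edge,
reached by `refl`. The analogue `homSix_mem` gives at most two further edges at a vertex of type
`B`. -/
theorem homFour_mem (x : DihedralGroup 4) :
    (∃ y, homFour x = homTwo y) ∨ ∃ y, homFour x = refl * homTwo y := by
  revert x; decide

theorem homSix_mem (x : DihedralGroup 6) :
    (∃ y, homSix x = homTwo y) ∨ (∃ y, homSix x = rotSix * homTwo y) ∨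
      ∃ y, homSix x = rotSix ^ 2 * homTwo y := by
  revert x; decide

theorem homTwo_mem_four (x : DihedralGroup 2) : ∃ y, homFour y = homTwo x := by
  revert x; decide
theorem homTwo_mem_six (x : DihedralGroup 2) : ∃ y, homSix y = homTwo x := by
  revert x; decide

end GLTwoInt

namespace GLTwoInt

theorem range_homTwo_le_four : homTwo.range ≤ homFour.range := by
  rintro _ ⟨x, rfl⟩
  exact homTwo_mem_four x

theorem range_homTwo_le_six : homTwo.range ≤ homSix.range := by
  rintro _ ⟨x, rfl⟩
  exact homTwo_mem_six x

/-- `SL₂(ℤ)` is generated by `S = rotFour` and `T = rotFour⁻¹ * rotSix`; `swap` accounts for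
determinant `-1`. -/
theorem range_sup_range : homFour.range ⊔ homSix.range = ⊤ := by
  set H := homFour.range ⊔ homSix.range
  have hS : rotFour ∈ H := le_sup_left (a := homFour.range) ⟨.r 1, by decide⟩
  have hs : swap ∈ H := le_sup_left (a := homFour.range) ⟨.sr 0, by decide⟩
  have hU : rotSix ∈ H := le_sup_right (b := homSix.range) ⟨.r 1, by decide⟩
  have hSL : (⊤ : Subgroup (Matrix.SpecialLinearGroup (Fin 2) ℤ)) ≤
      H.comap Matrix.SpecialLinearGroup.toGL := by
    rw [← SpecialLinearGroup.SL2Z_generators, Subgroup.closure_le]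
    rintro _ (rfl | rfl)
    · have : Matrix.SpecialLinearGroup.toGL ModularGroup.S = rotFour := by
        ext i j; fin_cases i <;> fin_cases j <;> rfl
      simpa [this] using hS
    · have : Matrix.SpecialLinearGroup.toGL ModularGroup.T = rotFour⁻¹ * rotSix := by
        ext i j; fin_cases i <;> fin_cases j <;> rfl
      simpa [this] using H.mul_mem (H.inv_mem hS) hU
  have hdet (g : GL (Fin 2) ℤ) (h : (g : Matrix (Fin 2) (Fin 2) ℤ).det = 1) : g ∈ H := by
    have hg : Matrix.SpecialLinearGroup.toGL ⟨g, h⟩ ∈ H := hSL (Subgroup.mem_top _)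
    convert hg using 1
    ext; rfl
  refine (Subgroup.eq_top_iff' H).2 fun g => ?_
  rcases Int.isUnit_iff.1 ((Matrix.isUnit_iff_isUnit_det _).1 g.isUnit) with h | h
  · exact hdet g h
  · have h2 := hdet (g * swap) (by
      rw [Units.val_mul, Matrix.det_mul, h]; decide)
    simpa using H.mul_mem h2 (H.inv_mem hs)

/-- The inner product of the columns of a matrix. -/
def colInner (g : GL (Fin 2) ℤ) : ℤ := g 0 0 * g 0 1 + g 1 0 * g 1 1

theorem colInner_mul_homTwo (g : GL (Fin 2) ℤ) (x : DihedralGroup 2) :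
    colInner (g * homTwo x) = colInner g := by
  rcases homTwo_mem x with h | h | h | h <;> rw [h] <;>
    simp [colInner, swap, Matrix.mul_apply, Fin.sum_univ_two] <;> ring

theorem colInner_mul_refl (g : GL (Fin 2) ℤ) : colInner (g * refl) = -colInner g := by
  simp [colInner, refl, Matrix.mul_apply, Fin.sum_univ_two]; ring

theorem colInner_mul_rotSix (g : GL (Fin 2) ℤ) :
    colInner (g * rotSix) = g 0 1 ^ 2 + g 1 1 ^ 2 - colInner g := by
  simp [colInner, rotSix, Matrix.mul_apply, Fin.sum_univ_two]; ring

theorem colInner_mul_rotSix_sq (g : GL (Fin 2) ℤ) :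
    colInner (g * rotSix ^ 2) = g 0 0 ^ 2 + g 1 0 ^ 2 - colInner g := by
  simp [colInner, rotSix, pow_two, Matrix.mul_apply, Fin.sum_univ_two]; ring

theorem col_sq_pos (g : GL (Fin 2) ℤ) (j : Fin 2) : 0 < g 0 j ^ 2 + g 1 j ^ 2 := by
  by_contra! h
  have h0 : g 0 j = 0 := by nlinarith [sq_nonneg (g 0 j), sq_nonneg (g 1 j)]
  have h1 : g 1 j = 0 := by nlinarith [sq_nonneg (g 0 j), sq_nonneg (g 1 j)]
  have hu := (Matrix.isUnit_iff_isUnit_det _).1 g.isUnit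
  rw [Matrix.det_eq_zero_of_column_eq_zero j] at hu
  · simp at hu
  · intro i; fin_cases i
    · exact h0
    · exact h1

/-- The height of an edge of the tree of `GL₂(ℤ)`. -/
def height : GL (Fin 2) ℤ ⧸ homTwo.range → ℤ :=
  Quotient.lift (fun g => if colInner g < 0 then -2 * colInner g + 1 else 2 * colInner g)
    fun a b hab => by
      obtain ⟨x, hx⟩ := QuotientGroup.leftRel_apply.mp hab
      rw [show b = a * homTwo x by rw [hx, mul_inv_cancel_left], colInner_mul_homTwo]

theorem height_mk (g : GL (Fin 2) ℤ) : height (g : GL (Fin 2) ℤ ⧸ homTwo.range) =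
    if colInner g < 0 then -2 * colInner g + 1 else 2 * colInner g := rfl

theorem mk_mul_homTwo (g : GL (Fin 2) ℤ) (x : DihedralGroup 2) :
    ((g * homTwo x : GL (Fin 2) ℤ) : GL (Fin 2) ℤ ⧸ homTwo.range) = g :=
  QuotientGroup.mk_mul_of_mem g ⟨x, rfl⟩

/-- An edge is a basis `{c₀, c₁}` of `ℤ²`, unordered and up to a common sign; let `q = c₀ · c₁`. The
other edge at the `A`-end has inner product `-q`, the others at the `B`-end have `|c₁|² - q` and
`|c₀|² - q`. If `q > 0`, the `A`-end works: the summand 1 given to negative values in `height`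
breaks the tie between `q` and `-q`. If `q ≤ 0`, the `B`-end works, since `|cᵢ|² - q ≥ |q| + 1`,
which doubled exceeds `2|q| + 1`. -/
theorem height_lt (e : GL (Fin 2) ℤ ⧸ homTwo.range) :
    (∀ e', Subgroup.quotientMapOfLE range_homTwo_le_four e' =
      Subgroup.quotientMapOfLE range_homTwo_le_four e → e' ≠ e → height e < height e') ∨
    (∀ e', Subgroup.quotientMapOfLE range_homTwo_le_six e' =
      Subgroup.quotientMapOfLE range_homTwo_le_six e → e' ≠ e → height e < height e') := by
  induction e using QuotientGroup.induction_on with | H g => ?_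
  rcases lt_or_ge 0 (colInner g) with hq | hq
  · left
    intro e' he hne
    induction e' using QuotientGroup.induction_on with | H g' => ?_
    obtain ⟨x, hx⟩ := QuotientGroup.eq.1 he.symm
    obtain rfl : g' = g * homFour x := by rw [hx, id, id, mul_inv_cancel_left]
    rcases homFour_mem x with ⟨y, hy⟩ | ⟨y, hy⟩
    · rw [hy, mk_mul_homTwo] at hne
      exact absurd rfl hne
    · rw [hy, ← mul_assoc, mk_mul_homTwo, height_mk, height_mk, colInner_mul_refl,
        if_neg (by lia), if_pos (by lia)]
      lia
  · right
    intro e' he hne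
    induction e' using QuotientGroup.induction_on with | H g' => ?_
    obtain ⟨x, hx⟩ := QuotientGroup.eq.1 he.symm
    obtain rfl : g' = g * homSix x := by rw [hx, id, id, mul_inv_cancel_left]
    have h0 := col_sq_pos g 0
    have h1 := col_sq_pos g 1
    rcases homSix_mem x with ⟨y, hy⟩ | ⟨y, hy⟩ | ⟨y, hy⟩
    · rw [hy, mk_mul_homTwo] at hne
      exact absurd rfl hne
    · rw [hy, ← mul_assoc, mk_mul_homTwo, height_mk, height_mk, colInner_mul_rotSix,
        if_neg (not_lt.2 (by lia : 0 ≤ g 0 1 ^ 2 + g 1 1 ^ 2 - colInner g))]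
      split_ifs <;> lia
    · rw [hy, ← mul_assoc, mk_mul_homTwo, height_mk, height_mk, colInner_mul_rotSix_sq,
        if_neg (not_lt.2 (by lia : 0 ≤ g 0 0 ^ 2 + g 1 0 ^ 2 - colInner g))]
      split_ifs <;> lia

theorem hasFiniteCohomology_and_eulerChar (M : Rep.{0} ℚ (GL (Fin 2) ℤ)) [Module.Finite ℚ M] :
    HasFiniteCohomology M ∧ homologicalEulerChar M =
      Module.finrank ℚ (M.ρ.fixedVectors homFour.range) +
        Module.finrank ℚ (M.ρ.fixedVectors homSix.range) -
          Module.finrank ℚ (M.ρ.fixedVectors homTwo.range) :=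
  hasFiniteCohomology_and_eulerChar_of_tree range_homTwo_le_four range_homTwo_le_six
    range_sup_range height height_lt M

end GLTwoInt

/-! ### The monomial basis of `Symᵐ ℚ²` and traces of induced maps. -/

namespace SymmetricPower

/-- The linear map out of `Symⁿ V` induced by a symmetric multilinear map. -/
noncomputable def lift {R V W : Type} [CommRing R] [AddCommGroup V] [Module R V] [AddCommGroup W]
    [Module R W] {n : ℕ} (f : MultilinearMap R (fun _ : Fin n => V) W)
    (hf : ∀ (e : Equiv.Perm (Fin n)) (v : Fin n → V), f (fun i => v (e i)) = f v) :
    SymmetricPower R (Fin n) V →ₗ[R] W where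
  __ := AddCon.lift (addConGen (SymmetricPower.Rel R (Fin n) V))
    (PiTensorProduct.lift f).toAddMonoidHom
    (by
      refine AddCon.addConGen_le.2 ?_
      intro x y h
      cases h with
      | perm e g =>
        simp only [AddCon.ker_rel, LinearMap.toAddMonoidHom_coe, PiTensorProduct.lift.tprod]
        exact (hf e g).symm)
  map_smul' r x := by
    induction x using AddCon.induction_on with
    | H x => exact (PiTensorProduct.lift f).map_smul r x

theorem lift_tprod {R V W : Type} [CommRing R] [AddCommGroup V] [Module R V] [AddCommGroup W]
    [Module R W] {n : ℕ} (f : MultilinearMap R (fun _ : Fin n => V) W)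
    (hf : ∀ (e : Equiv.Perm (Fin n)) (v : Fin n → V), f (fun i => v (e i)) = f v)
    (v : Fin n → V) : lift f hf (SymmetricPower.tprod R v) = f v :=
  PiTensorProduct.lift.tprod v

theorem map_neg_one_smul {R V : Type} [CommRing R] [AddCommGroup V] [Module R V]
    (n : ℕ) (f : V →ₗ[R] V) : map n (-f) = (-1 : R) ^ n • map n f :=
  hom_ext fun v => by
    rw [map_tprod, LinearMap.smul_apply, map_tprod]
    have := (SymmetricPower.tprod R).map_smul_univ (fun _ : Fin n => (-1 : R)) fun i => f (v i)
    simpa using this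

open Polynomial

/-- The linear polynomial `v₀ X + v₁`. -/
noncomputable def linearPoly : (Fin 2 → ℚ) →ₗ[ℚ] ℚ[X] :=
  LinearMap.toSpanSingleton ℚ ℚ[X] X ∘ₗ LinearMap.proj 0 +
    LinearMap.toSpanSingleton ℚ ℚ[X] 1 ∘ₗ LinearMap.proj 1

theorem linearPoly_apply (v : Fin 2 → ℚ) : linearPoly v = C (v 0) * X + C (v 1) := by
  simp [linearPoly, smul_eq_C_mul]

/-- The map from `Symᵐ ℚ²` to polynomials, sending `v₁ ⋯ vₘ` to the product of the linear
polynomials of the `vᵢ`. -/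
noncomputable def toPoly (m : ℕ) : SymmetricPower ℚ (Fin m) (Fin 2 → ℚ) →ₗ[ℚ] ℚ[X] :=
  lift ((MultilinearMap.mkPiAlgebra ℚ (Fin m) ℚ[X]).compLinearMap fun _ => linearPoly)
    fun e v => by
      simpa using Equiv.prod_comp e fun i => linearPoly (v i)

theorem toPoly_tprod {m : ℕ} (v : Fin m → Fin 2 → ℚ) :
    toPoly m (SymmetricPower.tprod ℚ v) = ∏ i, linearPoly (v i) := by
  rw [toPoly, lift_tprod]
  simp

theorem prod_ite_val_lt {M : Type*} [CommMonoid M] {m k : ℕ} (hk : k ≤ m) (p q : M) :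
    (∏ i : Fin m, if i.val < k then p else q) = p ^ k * q ^ (m - k) := by
  rw [Fin.prod_univ_eq_prod_range (fun i => if i < k then p else q) m,
    ← Finset.prod_range_mul_prod_Ico _ hk,
    Finset.prod_congr rfl fun i hi => if_pos (Finset.mem_range.1 hi),
    Finset.prod_congr rfl fun i hi => if_neg (not_lt.2 (Finset.mem_Ico.1 hi).1)]
  simp

/-- Such a map is a block of zeros followed by a block of ones; the cut is the least index from
which the value is 1. -/
theorem exists_eq_ite_of_monotone {m : ℕ} (g : Fin m → Fin 2) (hg : Monotone g) :
    ∃ k ≤ m, ∀ i, g i = if i.val < k then 0 else 1 := by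
  classical
  have hex : ∃ k, ∀ i : Fin m, k ≤ i.val → g i = 1 := ⟨m, fun i hi => absurd i.2 (not_lt.2 hi)⟩
  refine ⟨Nat.find hex, Nat.find_min' hex fun i hi => absurd i.2 (not_lt.2 hi), fun i => ?_⟩
  split_ifs with h
  · by_contra hi
    refine Nat.find_min hex h fun j hj => ?_
    have := hg (show i ≤ j from hj)
    lia
  · exact Nat.find_spec hex i (not_lt.1 h)

/-- The product `e₀ᵏ e₁ᵐ⁻ᵏ` in `Symᵐ ℚ²`. -/
noncomputable def monomialVec (m k : ℕ) : SymmetricPower ℚ (Fin m) (Fin 2 → ℚ) :=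
  SymmetricPower.tprod ℚ fun i => if i.val < k then Pi.single 0 1 else Pi.single 1 1

theorem toPoly_map_monomialVec {m k : ℕ} (hk : k ≤ m) (f : (Fin 2 → ℚ) →ₗ[ℚ] (Fin 2 → ℚ)) :
    toPoly m (map m f (monomialVec m k)) =
      linearPoly (f (Pi.single 0 1)) ^ k * linearPoly (f (Pi.single 1 1)) ^ (m - k) := by
  rw [monomialVec, map_tprod, toPoly_tprod, ← prod_ite_val_lt hk]
  exact Finset.prod_congr rfl fun i _ => by split_ifs <;> rfl

theorem toPoly_monomialVec {m k : ℕ} (hk : k ≤ m) : toPoly m (monomialVec m k) = X ^ k := by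
  have h := prod_ite_val_lt hk (X : ℚ[X]) 1
  rw [one_pow, mul_one] at h
  rw [monomialVec, toPoly_tprod, ← h]
  exact Finset.prod_congr rfl fun i _ => by split_ifs <;> simp [linearPoly_apply]

/-- Expand each factor in `e₀, e₁`. Every resulting product of basis vectors can be sorted, because
factors commute in the symmetric power. -/
theorem span_monomialVec (m : ℕ) :
    ⊤ ≤ Submodule.span ℚ (Set.range fun k : Fin (m + 1) => monomialVec m k) := by
  rw [← span_tprod_eq_top, Submodule.span_le]
  rintro _ ⟨v, rfl⟩
  have hv : v = fun i => ∑ j : Fin 2, v i j • (Pi.single j 1 : Fin 2 → ℚ) := by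
    ext i j
    fin_cases j <;> simp
  rw [hv, MultilinearMap.map_sum]
  refine Submodule.sum_mem _ fun r _ => ?_
  rw [MultilinearMap.map_smul_univ]
  refine Submodule.smul_mem _ _ ?_
  rw [← tprod_equiv (Tuple.sort r)]
  obtain ⟨k, hk, h⟩ := exists_eq_ite_of_monotone _ (Tuple.monotone_sort r)
  refine Submodule.subset_span ⟨⟨k, Nat.lt_succ_of_le hk⟩, ?_⟩
  refine congrArg (SymmetricPower.tprod ℚ) (funext fun i => ?_)
  have hi : r (Tuple.sort r i) = _ := h i
  rw [hi]
  split_ifs <;> rfl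

/-- The images under `toPoly` are distinct powers of `X`. -/
theorem linearIndependent_monomialVec (m : ℕ) :
    LinearIndependent ℚ fun k : Fin (m + 1) => monomialVec m k := by
  refine LinearIndependent.of_comp (toPoly m) ?_
  have h : (toPoly m ∘ fun k : Fin (m + 1) => monomialVec m k) =
      (fun k : ℕ => (X ^ k : ℚ[X])) ∘ Fin.val :=
    funext fun k => toPoly_monomialVec (Nat.lt_succ_iff.1 k.2)
  rw [h]
  refine LinearIndependent.comp ?_ _ Fin.val_injective
  simpa [Polynomial.X_pow_eq_monomial] using! (Polynomial.basisMonomials ℚ).linearIndependent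

/-- The monomial basis of `Symᵐ ℚ²`. -/
noncomputable def monomialBasis (m : ℕ) :
    Module.Basis (Fin (m + 1)) ℚ (SymmetricPower ℚ (Fin m) (Fin 2 → ℚ)) :=
  Module.Basis.mk (linearIndependent_monomialVec m) (span_monomialVec m)

instance (m : ℕ) : Module.Finite ℚ (SymmetricPower ℚ (Fin m) (Fin 2 → ℚ)) :=
  Module.Finite.of_basis (monomialBasis m)

theorem monomialBasis_repr (m : ℕ) (x : SymmetricPower ℚ (Fin m) (Fin 2 → ℚ)) (k : Fin (m + 1)) :
    (monomialBasis m).repr x k = (toPoly m x).coeff k := by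
  have : (monomialBasis m).coord k = (Polynomial.lcoeff ℚ k) ∘ₗ toPoly m :=
    (monomialBasis m).ext fun j => by
      rw [Module.Basis.coord_apply, Module.Basis.repr_self, LinearMap.comp_apply, monomialBasis,
        Module.Basis.mk_apply, toPoly_monomialVec (Nat.lt_succ_iff.1 j.2), lcoeff_apply,
        coeff_X_pow, Finsupp.single_apply]
      simp [Fin.ext_iff, eq_comm]
  exact LinearMap.congr_fun this x

/-- In the dehomogenized model the `k`-th diagonal entry is the coefficient of `X ^ k` in the image
of the `k`-th basis monomial. -/
theorem trace_map (m : ℕ) (f : (Fin 2 → ℚ) →ₗ[ℚ] (Fin 2 → ℚ)) :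
    LinearMap.trace ℚ _ (map m f) = ∑ k ∈ Finset.range (m + 1),
      (linearPoly (f (Pi.single 0 1)) ^ k * linearPoly (f (Pi.single 1 1)) ^ (m - k)).coeff k := by
  rw [LinearMap.trace_eq_matrix_trace ℚ (monomialBasis m), Matrix.trace, Finset.sum_range]
  refine Finset.sum_congr rfl fun k _ => ?_
  rw [Matrix.diag_apply, LinearMap.toMatrix_apply, monomialBasis_repr, monomialBasis,
    Module.Basis.mk_apply, toPoly_map_monomialVec (Nat.lt_succ_iff.1 k.2)]

end SymmetricPower

/-! ### Characters: dimensions of fixed spaces and character values on `Symᵐ V₂`. -/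

/-- Averaging over `K` projects onto the fixed vectors, and the trace of a projection is its rank.
Averaging over `K` rather than over its image makes injectivity of `φ` unnecessary. -/
theorem Representation.card_mul_finrank_fixedVectors {G K V : Type*} [Group G] [Group K]
    [Fintype K] [AddCommGroup V] [Module ℚ V] [Module.Finite ℚ V] (ρ : Representation ℚ G V)
    (φ : K →* G) :
    (Fintype.card K : ℚ) * Module.finrank ℚ (ρ.fixedVectors φ.range) =
      ∑ x : K, LinearMap.trace ℚ V (ρ (φ x)) := by
  have hc : (Fintype.card K : ℚ) ≠ 0 := by simp
  let := invertibleOfNonzero hc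
  let σ : Representation ℚ K V := MonoidHom.comp ρ φ
  have h : ρ.fixedVectors φ.range = σ.invariants := by
    ext v
    simp [Representation.mem_fixedVectors, σ]
  have ht := σ.isProj_averageMap.trace
  rw [h, ← ht]
  simp [GroupAlgebra.average, map_sum, σ, hc]

theorem DihedralGroup.sum_eq {n : ℕ} [NeZero n] {M : Type*} [AddCommMonoid M]
    (f : DihedralGroup n → M) : ∑ x, f x = (∑ i, f (r i)) + ∑ i, f (sr i) := by
  rw [← DihedralGroup.equivSum.symm.sum_comp, Fintype.sum_sum_type]
  rfl

namespace GLTwoInt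

open Polynomial

/-- The character of `Symᵐ V₂`. -/
noncomputable def symChar (m : ℕ) (g : GL (Fin 2) ℤ) : ℚ :=
  LinearMap.trace ℚ _ (standardRep.symPow m g)

theorem symChar_eq_sum (m : ℕ) (g : GL (Fin 2) ℤ) :
    symChar m g = ∑ k ∈ Finset.range (m + 1),
      ((C (g 0 0 : ℚ) * X + C (g 1 0 : ℚ)) ^ k *
        (C (g 0 1 : ℚ) * X + C (g 1 1 : ℚ)) ^ (m - k)).coeff k := by
  refine (SymmetricPower.trace_map m _).trans (Finset.sum_congr rfl fun k _ => ?_)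
  simp [standardRep, SymmetricPower.linearPoly_apply]

theorem symChar_swap (j : ℕ) : symChar (2 * j) swap = 1 := by
  rw [symChar_eq_sum, Finset.sum_eq_single j]
  · simp [swap, coeff_X_pow]; lia
  · intro k hk hne
    simp [swap, coeff_X_pow]; lia
  · simp; lia

theorem coeff_neg_X_pow (n k : ℕ) :
    ((-X : ℚ[X]) ^ n).coeff k = if k = n then (-1) ^ n else 0 := by
  rw [neg_pow, ← C_1, ← C_neg, ← C_pow, coeff_C_mul_X_pow]

theorem symChar_rotFour (j : ℕ) :
    symChar (2 * j) rotFour = (-1) ^ j := by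
  rw [symChar_eq_sum, Finset.sum_eq_single j]
  · rw [show 2 * j - j = j by lia]
    simp [rotFour, coeff_neg_X_pow]
  · intro k hk hne
    simp [rotFour, coeff_neg_X_pow]; lia
  · simp; lia

theorem symChar_refl (j : ℕ) :
    symChar (2 * j) refl = 1 := by
  rw [symChar_eq_sum]
  have h (k : ℕ) (hk : k ∈ Finset.range (2 * j + 1)) :
      ((C (refl 0 0 : ℚ) * X + C (refl 1 0 : ℚ)) ^ k *
        (C (refl 0 1 : ℚ) * X + C (refl 1 1 : ℚ)) ^ (2 * j - k)).coeff k = (-1) ^ k := by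
    have hk' : (-1 : ℚ) ^ (2 * j - k) = (-1) ^ k := by
      refine neg_one_pow_congr ?_
      rw [Nat.even_sub (Nat.lt_succ_iff.1 (Finset.mem_range.1 hk))]
      simp
    rw [← hk', show (-1 : ℚ) ^ (2 * j - k) = (C ((-1 : ℚ) ^ (2 * j - k)) * X ^ k).coeff k by
      rw [coeff_C_mul_X_pow, if_pos rfl]]
    congr 1
    simp [refl, mul_comm]
  rw [Finset.sum_congr rfl h, neg_one_geom_sum, if_neg (by simp)]

/-- The alternating sum of binomial coefficients along an antidiagonal satisfies the recurrence of
the Chebyshev polynomials at `1 / 2`. -/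
theorem sum_antidiagonal_neg_one_pow_choose (m : ℕ) :
    ∑ p ∈ Finset.HasAntidiagonal.antidiagonal (m + 2), (-1 : ℚ) ^ p.2 * (p.1.choose p.2 : ℚ) =
      ∑ p ∈ Finset.HasAntidiagonal.antidiagonal (m + 1), (-1 : ℚ) ^ p.2 * (p.1.choose p.2 : ℚ) -
        ∑ p ∈ Finset.HasAntidiagonal.antidiagonal m, (-1 : ℚ) ^ p.2 * (p.1.choose p.2 : ℚ) := by
  rw [Finset.Nat.antidiagonal_succ_succ', Finset.Nat.antidiagonal_succ']
  simp [Nat.choose_succ_succ, Finset.sum_add_distrib, pow_succ, mul_add]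
  ring

theorem coeff_one_sub_X_pow (n k : ℕ) :
    ((-X + 1 : ℚ[X]) ^ n).coeff k = (-1) ^ k * (n.choose k : ℚ) := by
  have h := comp_C_mul_X_coeff (p := (X + 1 : ℚ[X]) ^ n) (r := -1) (n := k)
  rw [coeff_X_add_one_pow] at h
  rw [mul_comm, ← h]
  simp

theorem symChar_rotSix (m : ℕ) :
    symChar m rotSix =
      ∑ p ∈ Finset.HasAntidiagonal.antidiagonal m, (-1 : ℚ) ^ p.2 * (p.1.choose p.2 : ℚ) := by
  rw [symChar_eq_sum, ← Finset.Nat.sum_antidiagonal_swap,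
    Finset.Nat.sum_antidiagonal_eq_sum_range_succ_mk]
  simp [rotSix, coeff_one_sub_X_pow]

/-- This is the recurrence of complete symmetric functions in the eigenvalues of `rotSix`, which has
trace 1 and determinant 1. -/
theorem symChar_rotSix_add_two (m : ℕ) :
    symChar (m + 2) rotSix =
      symChar (m + 1) rotSix -
        symChar m rotSix := by
  simp only [symChar_rotSix, sum_antidiagonal_neg_one_pow_choose]

/-- The recurrence gives a sign change after three steps, hence period six: the values are `1, 1, 0,
-1, -1, 0`. -/
theorem symChar_rotSix_add_six (m : ℕ) :
    symChar (m + 6) rotSix =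
      symChar m rotSix := by
  linarith [symChar_rotSix_add_two m, symChar_rotSix_add_two (m + 1), symChar_rotSix_add_two (m + 2),
    symChar_rotSix_add_two (m + 3), symChar_rotSix_add_two (m + 4)]

theorem symChar_rotSix_mul_add (n m : ℕ) :
    symChar (12 * n + m) rotSix =
      symChar m rotSix := by
  induction n with
  | zero => rw [mul_zero, zero_add]
  | succ n ih =>
    rw [← ih, ← symChar_rotSix_add_six (12 * n + m), ← symChar_rotSix_add_six (12 * n + m + 6)]
    congr 1; ring

theorem symChar_one (m : ℕ) :
    symChar m 1 = m + 1 := by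
  rw [symChar_eq_sum]
  simp

theorem symPow_neg (m : ℕ) (g : GL (Fin 2) ℤ) :
    standardRep.symPow m (-g) = (-1 : ℚ) ^ m • standardRep.symPow m g := by
  rw [show standardRep.symPow m (-g) = SymmetricPower.map m (standardRep (-g)) from rfl,
    show standardRep (-g) = -standardRep g by ext; simp [standardRep],
    SymmetricPower.map_neg_one_smul]
  rfl

end GLTwoInt

/-! ### Evaluation of the Euler characteristics. -/

namespace GLTwoInt

theorem sum_homTwo {χ : GL (Fin 2) ℤ → ℚ} (hneg : ∀ g, χ (-g) = χ g) :
    ∑ x, χ (homTwo x) = 2 * χ 1 + 2 * χ swap := by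
  have hs (f : ZMod 2 → ℚ) : ∑ i, f i = f 0 + f 1 := Fin.sum_univ_two f
  rw [DihedralGroup.sum_eq, hs, hs]
  rw [show homTwo (.r 0) = 1 by decide, show homTwo (.r 1) = -1 by decide,
    show homTwo (.sr 0) = swap by decide, show homTwo (.sr 1) = -swap by decide]
  simp only [hneg]
  ring

theorem sum_homFour {χ : GL (Fin 2) ℤ → ℚ} (hneg : ∀ g, χ (-g) = χ g) :
    ∑ x, χ (homFour x) = 2 * χ 1 + 2 * χ rotFour + 2 * χ swap + 2 * χ refl := by
  have hs (f : ZMod 4 → ℚ) : ∑ i, f i = f 0 + f 1 + f 2 + f 3 := Fin.sum_univ_four f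
  rw [DihedralGroup.sum_eq, hs, hs]
  rw [show homFour (.r 0) = 1 by decide, show homFour (.r 1) = rotFour by decide,
    show homFour (.r 2) = -1 by decide, show homFour (.r 3) = -rotFour by decide,
    show homFour (.sr 0) = swap by decide, show homFour (.sr 1) = refl by decide,
    show homFour (.sr 2) = -swap by decide, show homFour (.sr 3) = -refl by decide]
  simp only [hneg]
  ring

/-- Up to sign, all six reflections are conjugate to `swap`, and the rotations other than `±1` are
conjugate to `rotSix`. In the group of order eight, `swap` and `refl` have to be counted separately.
-/
theorem sum_homSix {χ : GL (Fin 2) ℤ → ℚ} (hneg : ∀ g, χ (-g) = χ g)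
    (hconj : ∀ g h, χ (h * g * h⁻¹) = χ g) :
    ∑ x, χ (homSix x) = 2 * χ 1 + 4 * χ rotSix + 6 * χ swap := by
  have hs (f : ZMod 6 → ℚ) : ∑ i, f i = f 0 + f 1 + f 2 + f 3 + f 4 + f 5 := Fin.sum_univ_six f
  rw [DihedralGroup.sum_eq, hs, hs]
  rw [show homSix (.r 0) = 1 by decide, show homSix (.r 1) = rotSix by decide,
    show homSix (.r 2) = -(swap * rotSix * swap⁻¹) by decide,
    show homSix (.r 3) = -1 by decide, show homSix (.r 4) = -rotSix by decide,
    show homSix (.r 5) = swap * rotSix * swap⁻¹ by decide,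
    show homSix (.sr 0) = swap by decide,
    show homSix (.sr 1) = -(rotSix * swap * rotSix⁻¹) by decide,
    show homSix (.sr 2) = rotSix⁻¹ * swap * rotSix⁻¹⁻¹ by decide,
    show homSix (.sr 3) = -swap by decide,
    show homSix (.sr 4) = rotSix * swap * rotSix⁻¹ by decide,
    show homSix (.sr 5) = -(rotSix⁻¹ * swap * rotSix⁻¹⁻¹) by decide]
  simp only [hneg, hconj]
  ring

theorem trace_conj (M : Rep.{0} ℚ (GL (Fin 2) ℤ)) (g h : GL (Fin 2) ℤ) :
    LinearMap.trace ℚ M (M.ρ (h * g * h⁻¹)) = LinearMap.trace ℚ M (M.ρ g) := by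
  rw [map_mul, LinearMap.trace_mul_comm, ← map_mul, ← mul_assoc, inv_mul_cancel, one_mul]

theorem eulerChar_eq (M : Rep.{0} ℚ (GL (Fin 2) ℤ)) [Module.Finite ℚ M] {χ : GL (Fin 2) ℤ → ℚ}
    (hχ : ∀ g, LinearMap.trace ℚ M (M.ρ g) = χ g) (hneg : ∀ g, χ (-g) = χ g) :
    (homologicalEulerChar M : ℚ) = (χ 1 + χ rotFour + χ swap + χ refl) / 4 +
      (χ 1 + 2 * χ rotSix + 3 * χ swap) / 6 - (χ 1 + χ swap) / 2 := by
  have h4 := M.ρ.card_mul_finrank_fixedVectors homFour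
  have h6 := M.ρ.card_mul_finrank_fixedVectors homSix
  have h2 := M.ρ.card_mul_finrank_fixedVectors homTwo
  simp only [hχ, DihedralGroup.card] at h4 h6 h2
  rw [sum_homFour hneg] at h4
  rw [sum_homTwo hneg] at h2
  rw [sum_homSix hneg fun g h => by rw [← hχ, ← hχ, trace_conj]] at h6
  rw [(hasFiniteCohomology_and_eulerChar M).2]
  push_cast at h4 h6 h2 ⊢
  linarith

/-- All three stabilizers contain `-1`, so a fixed vector satisfies `v = -v`. -/
theorem eulerChar_eq_zero (M : Rep.{0} ℚ (GL (Fin 2) ℤ)) [Module.Finite ℚ M]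
    (h : M.ρ (-1) = -1) : homologicalEulerChar M = 0 := by
  have hb (H : Subgroup (GL (Fin 2) ℤ)) (hH : homTwo.range ≤ H) :
      Module.finrank ℚ (M.ρ.fixedVectors H) = 0 := by
    have : M.ρ.fixedVectors H = ⊥ := (Submodule.eq_bot_iff _).2 fun v hv => by
      have h1 := Representation.mem_fixedVectors.1 hv (-1) (hH ⟨.r 1, by decide⟩)
      rw [h] at h1
      have h2 : (2 : ℚ) • v = 0 := by rw [two_smul]; nth_rw 1 [← h1]; exact neg_add_cancel v
      exact (smul_eq_zero.1 h2).resolve_left two_ne_zero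
    rw [this, finrank_bot]
  rw [(hasFiniteCohomology_and_eulerChar M).2, hb _ range_homTwo_le_four,
    hb _ range_homTwo_le_six, hb _ le_rfl]
  simp

instance (m : ℕ) : Module.Finite ℚ (symV m) :=
  inferInstanceAs (Module.Finite ℚ (SymmetricPower ℚ (Fin m) (Fin 2 → ℚ)))

instance (m : ℕ) : Module.Finite ℚ (symVDet m) :=
  inferInstanceAs (Module.Finite ℚ (SymmetricPower ℚ (Fin m) (Fin 2 → ℚ) ⊗[ℚ] ℚ))

theorem symChar_neg {m : ℕ} (hm : Even m) (g : GL (Fin 2) ℤ) : symChar m (-g) = symChar m g := by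
  rw [symChar, symPow_neg, hm.neg_one_pow, one_smul, symChar]

theorem trace_symV (m : ℕ) (g : GL (Fin 2) ℤ) :
    LinearMap.trace ℚ (symV m) ((symV m).ρ g) = symChar m g := rfl

theorem trace_symVDet (m : ℕ) (g : GL (Fin 2) ℤ) :
    LinearMap.trace ℚ (symVDet m) ((symVDet m).ρ g) =
      symChar m g * ((g : Matrix (Fin 2) (Fin 2) ℤ).det : ℤ) := by
  have h : LinearMap.trace ℚ ℚ (detRep g) = ((g : Matrix (Fin 2) (Fin 2) ℤ).det : ℤ) := by
    rw [show detRep g = (((g : Matrix (Fin 2) (Fin 2) ℤ).det : ℤ) : ℚ) • LinearMap.id from rfl,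
      map_smul, LinearMap.trace_id, Module.finrank_self, Nat.cast_one, smul_eq_mul, mul_one]
  rw [← h]
  exact LinearMap.trace_tensorProduct' (standardRep.symPow m g) (detRep g)

theorem eulerChar_symV (j : ℕ) : (homologicalEulerChar (symV (2 * j)) : ℚ) =
    (2 * j + 3 + (-1) ^ j) / 4 + (2 * j + 4 + 2 * symChar (2 * j) rotSix) / 6 - (j + 1) := by
  rw [eulerChar_eq _ (trace_symV _) (symChar_neg (even_two_mul j)), symChar_one, symChar_rotFour,
    symChar_swap, symChar_refl]
  push_cast
  ring

theorem eulerChar_symVDet (j : ℕ) : (homologicalEulerChar (symVDet (2 * j)) : ℚ) =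
    (2 * j - 1 + (-1) ^ j) / 4 + (2 * j - 2 + 2 * symChar (2 * j) rotSix) / 6 - j := by
  rw [eulerChar_eq _ (trace_symVDet _) fun g => by
      rw [symChar_neg (even_two_mul j), Units.val_neg, Matrix.det_neg]; simp,
    symChar_one, symChar_rotFour, symChar_swap, symChar_refl,
    show ((1 : GL (Fin 2) ℤ) : Matrix (Fin 2) (Fin 2) ℤ).det = 1 by decide,
    show (rotFour : Matrix (Fin 2) (Fin 2) ℤ).det = 1 by decide,
    show (rotSix : Matrix (Fin 2) (Fin 2) ℤ).det = 1 by decide,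
    show (swap : Matrix (Fin 2) (Fin 2) ℤ).det = -1 by decide,
    show (refl : Matrix (Fin 2) (Fin 2) ℤ).det = -1 by decide]
  push_cast
  ring

theorem symPow_neg_one {m : ℕ} (hm : Odd m) : standardRep.symPow m (-1) = (-1 : ℚ) • 1 := by
  rw [symPow_neg, hm.neg_one_pow, map_one]

theorem symV_neg_one {m : ℕ} (hm : Odd m) : (symV m).ρ (-1) = -1 :=
  (symPow_neg_one hm).trans (neg_one_smul ℚ (1 : Module.End ℚ (symV m)))

theorem symVDet_neg_one {m : ℕ} (hm : Odd m) : (symVDet m).ρ (-1) = -1 := by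
  have h2 : detRep (-1) = LinearMap.id := by
    rw [show detRep (-1) = ((((-1 : GL (Fin 2) ℤ) : Matrix (Fin 2) (Fin 2) ℤ).det : ℤ) : ℚ) •
      LinearMap.id from rfl,
      show ((-1 : GL (Fin 2) ℤ) : Matrix (Fin 2) (Fin 2) ℤ).det = 1 by decide]
    simp
  refine (show (symVDet m).ρ (-1) =
    TensorProduct.map (standardRep.symPow m (-1)) (detRep (-1)) from rfl).trans ?_
  rw [symPow_neg_one hm, h2, TensorProduct.map_smul_left, Module.End.one_eq_id,
    TensorProduct.map_id]
  exact neg_one_smul ℚ (1 : Module.End ℚ (symVDet m))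

theorem symChar_rotSix_zero : symChar 0 rotSix = 1 := by simp [symChar_rotSix]

theorem symChar_rotSix_one : symChar 1 rotSix = 1 := by
  simp [symChar_rotSix, Finset.Nat.antidiagonal_succ]

theorem symChar_rotSix_two : symChar 2 rotSix = 0 := by
  rw [symChar_rotSix_add_two 0, symChar_rotSix_zero, zero_add, symChar_rotSix_one, sub_self]

theorem symChar_rotSix_four : symChar 4 rotSix = -1 := by
  rw [symChar_rotSix_add_two 2, symChar_rotSix_add_two 1, symChar_rotSix_two, symChar_rotSix_one]
  norm_num

end GLTwoInt

open GLTwoInt in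
theorem theorem5p5 :
    (∀ m : ℕ, HasFiniteCohomology (symV m) ∧ HasFiniteCohomology (symVDet m)) ∧
    ∀ n : ℕ,
      (homologicalEulerChar (symV (12 * n)) = -(n : ℤ) + 1 ∧
        homologicalEulerChar (symV (12 * n + 2)) = -(n : ℤ) ∧
        homologicalEulerChar (symV (12 * n + 4)) = -(n : ℤ) ∧
        homologicalEulerChar (symV (12 * n + 6)) = -(n : ℤ) ∧
        homologicalEulerChar (symV (12 * n + 8)) = -(n : ℤ) ∧
        homologicalEulerChar (symV (12 * n + 10)) = -(n : ℤ) - 1 ∧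
        ∀ k : ℕ, Odd k → homologicalEulerChar (symV (12 * n + k)) = 0) ∧
      (homologicalEulerChar (symVDet (12 * n)) = -(n : ℤ) ∧
        homologicalEulerChar (symVDet (12 * n + 2)) = -(n : ℤ) - 1 ∧
        homologicalEulerChar (symVDet (12 * n + 4)) = -(n : ℤ) - 1 ∧
        homologicalEulerChar (symVDet (12 * n + 6)) = -(n : ℤ) - 1 ∧
        homologicalEulerChar (symVDet (12 * n + 8)) = -(n : ℤ) - 1 ∧
        homologicalEulerChar (symVDet (12 * n + 10)) = -(n : ℤ) - 2 ∧
        ∀ k : ℕ, Odd k → homologicalEulerChar (symVDet (12 * n + k)) = 0) := by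
  refine ⟨fun m => ⟨(hasFiniteCohomology_and_eulerChar _).1,
    (hasFiniteCohomology_and_eulerChar _).1⟩, fun n => ?_⟩
  have hodd (k : ℕ) (hk : Odd k) : Odd (12 * n + k) :=
    Even.add_odd ⟨6 * n, by ring⟩ hk
  have hsign (i : ℕ) : (-1 : ℚ) ^ (6 * n + i) = (-1) ^ i := by
    rw [pow_add, pow_mul]; norm_num
  have u (i : ℕ) := symChar_rotSix_mul_add n i
  have u0 := (u 0).trans symChar_rotSix_zero
  have u2 := (u 2).trans symChar_rotSix_two
  have u4 := (u 4).trans symChar_rotSix_four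
  have u6 := (u 6).trans ((symChar_rotSix_add_six 0).trans symChar_rotSix_zero)
  have u8 := (u 8).trans ((symChar_rotSix_add_six 2).trans symChar_rotSix_two)
  have u10 := (u 10).trans ((symChar_rotSix_add_six 4).trans symChar_rotSix_four)
  rw [add_zero] at u0
  -- With `j = 6n + i` the weight `2j` is `12n + 2i`, so `i = 0, …, 5` covers the even residues
  -- modulo 12.
  have e (i : ℕ) := eulerChar_symV (6 * n + i)
  have d (i : ℕ) := eulerChar_symVDet (6 * n + i)
  simp only [hsign, mul_add, ← mul_assoc] at e d
  have e0 := e 0; have e1 := e 1; have e2 := e 2; have e3 := e 3; have e4 := e 4; have e5 := e 5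
  have d0 := d 0; have d1 := d 1; have d2 := d 2; have d3 := d 3; have d4 := d 4; have d5 := d 5
  norm_num [u0, u2, u4, u6, u8, u10] at e0 e1 e2 e3 e4 e5 d0 d1 d2 d3 d4 d5
  refine ⟨⟨?_, ?_, ?_, ?_, ?_, ?_, fun k hk => eulerChar_eq_zero _ (symV_neg_one (hodd k hk))⟩,
    ⟨?_, ?_, ?_, ?_, ?_, ?_, fun k hk => eulerChar_eq_zero _ (symVDet_neg_one (hodd k hk))⟩⟩ <;>
  · rw [← Int.cast_inj (α := ℚ)]
    push_cast
    linarith
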